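/- Let $\mathbb{K}$ be $\mathbb{R}$ or $\mathbb{C}$, let $m\ge 1$ be an integer, let $p\in(0,\infty)$, let $\lambda$ be the Lebesgue measure on $\mathbb{R}^m$, and let $X\subset\mathbb{R}^m$ be a Lebesgue measurable set. For $q\in(0,\infty]$ let $L_q(X)$ be the vector space of (almost-everywhere classes of) measurable functions $f\colon X\to\mathbb{K}$ such that $|f|^q$ is $\lambda$-integrable on $X$ (if $q<\infty$), or such that $f$ is $\lambda$-essentially bounded on $X$ (if $q=\infty$). The space $L_p(X)$ carries the vector topology given by the norm (if $p\ge 1$) or quasi-norm (if $p<1$) $\|f\|_p=\left(\int_X|f|^p\,d\lambda\right)^{1/p}$. Let $\alpha<\beta$ be cardinal numbers and let $A$ be a subset of a topological vector space $E$. The set $A$ is called $(\alpha,\beta)$-spaceable in $E$ if - there is a vector subspace $F$ of $E$ with $\dim F=\alpha$ and $F\smallsetminus\{0\}\subset A$, and - for every vector subspace $F_\alpha$ of $E$ with $\dim F_\alpha=\alpha$ and $F_\alpha\subset A\cup\{0\}$ there is a closed vector subspace $F_\beta$ of $E$ with $\dim F_\beta=\beta$ and $F_\alpha\subset F_\beta\subset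 A\cup\{0\}$. Here $\dim$ is the cardinality of a Hamel basis. Write $\mathfrak{c}=\operatorname{card}(\mathbb{R})$ and $\aleph_0=\operatorname{card}(\mathbb{N})$. Then $$\lambda(X)>0\quad\text{if and only if}\quad L_p(X)\smallsetminus\bigcup_{q\in(p,\infty]}L_q(X)\ \text{ is } (\alpha,\mathfrak{c})\text{-spaceable in } L_p(X)\text{ for all }\alpha<\aleph_0.$$ -/

import Mathlib

open MeasureTheory Cardinal
open scoped ENNReal Topology

universe u v

/-- `A` is `β`-lineable in the vector space `E`: some subspace `F` of `E` of dimension `β`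
satisfies `F \ {0} ⊆ A`. -/
def IsLineable (𝕜 : Type u) {E : Type v} [Field 𝕜] [AddCommGroup E] [Module 𝕜 E]
    (A : Set E) (β : Cardinal.{v}) : Prop :=
  ∃ F : Submodule 𝕜 E, Module.rank 𝕜 F = β ∧ (F : Set E) \ {0} ⊆ A

/-- `A` is `(α, β)`-spaceable in the vector space `E` with the vector topology `τ` (a notion
used for `α < β`): `A` is `α`-lineable, and every subspace of dimension `α` inside `A ∪ {0}` is
contained in a `τ`-closed subspace of dimension `β` inside `A ∪ {0}`.
The usual proviso `β ≤ dim E` is implied by the condition. -/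
def IsSpaceable (𝕜 : Type u) {E : Type v} [Field 𝕜] [AddCommGroup E] [Module 𝕜 E]
    (τ : TopologicalSpace E) (A : Set E) (α β : Cardinal.{v}) : Prop :=
  IsLineable 𝕜 A α ∧
    ∀ F : Submodule 𝕜 E, Module.rank 𝕜 F = α → (F : Set E) ⊆ A ∪ {0} →
      ∃ G : Submodule 𝕜 E, Module.rank 𝕜 G = β ∧ F ≤ G ∧ (G : Set E) ⊆ A ∪ {0} ∧
        IsClosed[τ] (G : Set E)

/-- The topology of the space `L_p(μ)` given by its norm (`1 ≤ p`) or quasi-norm (`0 < p < 1`)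
`‖f‖_p`: a set is open when it contains, around each of its points `f`, a ball
`{g | ‖g - f‖_p < ε}` with `ε > 0`. For `1 ≤ p` this is the usual norm topology; Mathlib has no
topology on `Lp` for `p < 1`. -/
@[reducible] def lpTopology (𝕜 : Type u) [RCLike 𝕜] {Ω : Type v} [MeasurableSpace Ω] (p : ℝ≥0∞)
    (μ : Measure Ω) : TopologicalSpace (Lp 𝕜 p μ) where
  IsOpen U := ∀ f ∈ U, ∃ ε : ℝ, 0 < ε ∧ ∀ g : Lp 𝕜 p μ, ‖g - f‖ < ε → g ∈ U
  isOpen_univ := fun _ _ => ⟨1, one_pos, fun _ _ => trivial⟩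
  isOpen_inter := fun U V hU hV f hf => by
    obtain ⟨ε, hε, h⟩ := hU f hf.1
    obtain ⟨δ, hδ, h'⟩ := hV f hf.2
    exact ⟨min ε δ, lt_min hε hδ, fun g hg =>
      ⟨h g (hg.trans_le (min_le_left _ _)), h' g (hg.trans_le (min_le_right _ _))⟩⟩
  isOpen_sUnion := fun S hS f ⟨U, hU, hf⟩ => by
    obtain ⟨ε, hε, h⟩ := hS U hU f hf
    exact ⟨ε, hε, fun g hg => ⟨U, hU, h g hg⟩⟩

/-- The set `L_p(μ) \ ⋃_{q ∈ (p, ∞]} L_q(μ)`, as a subset of `L_p(μ)`; all the spaces `L_q(μ)` are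
subsets of the space of almost-everywhere classes of measurable functions. -/
def lpDiffUnion (𝕜 : Type u) [RCLike 𝕜] {Ω : Type v} [MeasurableSpace Ω] (p : ℝ≥0∞)
    (μ : Measure Ω) : Set (Lp 𝕜 p μ) :=
  {f | (f : Ω →ₘ[μ] 𝕜) ∉ ⋃ q ∈ Set.Ioc p ∞, (Lp 𝕜 q μ : Set (Ω →ₘ[μ] 𝕜))}

open Filter Set

/-! If `F` is a finite-dimensional subspace of `A ∪ {0}`, where `A` is `lpDiffUnion`, all of `F` is
essentially bounded on some `Y` of positive finite measure. Inside `Y` one builds `g` in `L_p` and a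
partition into level sets of `k` such that `g` restricted to any level set is in no `L_q`, `q > p`.
Take `G = F + {c(k) g ∈ L_p}`. If `f + c(k) g` lies in `L_q`, then so does `f`: off `Y` the two
agree, and on `Y` `f` is bounded. Hence `f = 0`, and then every `c i g` on `{k = i}` is in `L_q`,
which forces `c(k) g = 0`. Closedness reduces to pointwise convergence on a conull set, and `G` has
dimension `𝔠` because the sequences `c` supply `𝔠` independent elements and bound the cardinality.
Conversely, a null `X` gives `L_p = 0`, without lines. -/

/-! ### A function in `L_p` that is in no `L_q` on each of countably many pieces -/

/-- In a non-atomic measure on a separable metric space, any set of positive finite measure contains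
disjoint sets of positive and arbitrarily small measure. -/
theorem exists_pairwise_disjoint_measure_le {Ω : Type v} [MetricSpace Ω]
    [SecondCountableTopology Ω] [MeasurableSpace Ω] [OpensMeasurableSpace Ω] {μ : Measure Ω}
    [NullSingletonClass μ] {Y : Set Ω} (hY : MeasurableSet Y) (h0 : μ Y ≠ 0) (hfin : μ Y ≠ ∞)
    {δ : ℕ → ℝ≥0∞} (hδ : ∀ n, 0 < δ n) :
    ∃ Z : ℕ → Set Ω, (∀ n, MeasurableSet (Z n)) ∧ (∀ n, Z n ⊆ Y) ∧
      Pairwise (Function.onFun Disjoint Z) ∧ ∀ n, 0 < μ (Z n) ∧ μ (Z n) ≤ δ n := by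
  obtain ⟨x, -, hx⟩ := exists_mem_forall_mem_nhdsWithin_pos_measure h0
  have hpos : ∀ r : ℝ, 0 < r → 0 < μ (Y ∩ Metric.closedBall x r) := fun r hr =>
    hx _ (inter_mem_nhdsWithin _ (Metric.closedBall_mem_nhds x hr))
  have hmeas : ∀ r : ℝ, MeasurableSet (Y ∩ Metric.closedBall x r) := fun r =>
    hY.inter Metric.isClosed_closedBall.measurableSet
  have hfin' : ∀ r : ℝ, μ (Y ∩ Metric.closedBall x r) ≠ ∞ := fun r =>
    ne_top_of_le_ne_top hfin (measure_mono inter_subset_left)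
  have hlim : Tendsto (μ ∘ fun r : ℝ => Y ∩ Metric.closedBall x r) (𝓝[>] 0) (𝓝 0) := by
    have := tendsto_measure_biInter_gt (μ := μ) (s := fun r : ℝ => Y ∩ Metric.closedBall x r)
      (a := 0) (fun r _ => (hmeas r).nullMeasurableSet)
      (fun i j _ hij => inter_subset_inter_right _ (Metric.closedBall_subset_closedBall hij))
      ⟨1, one_pos, hfin' 1⟩
    have h' : μ (⋂ r > (0 : ℝ), Y ∩ Metric.closedBall x r) = 0 := by
      refine measure_mono_null (t := {x}) (fun y hy => ?_) (measure_singleton x)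
      simp only [mem_iInter] at hy
      refine dist_le_zero.1 (le_of_forall_gt_imp_ge_of_dense fun r hr => (hy r hr).2)
    rwa [h'] at this
  have hstep : ∀ ε : ℝ≥0∞, 0 < ε → ∃ r : ℝ, 0 < r ∧ μ (Y ∩ Metric.closedBall x r) < ε := by
    intro ε hε
    obtain ⟨r, hr, hr0⟩ := ((hlim.eventually (gt_mem_nhds hε)).and self_mem_nhdsWithin).exists
    exact ⟨r, hr0, hr⟩
  let f : ∀ ε : {ε : ℝ≥0∞ // 0 < ε}, ℝ := fun ε => (hstep ε.1 ε.2).choose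
  have hf0 : ∀ ε, 0 < f ε := fun ε => (hstep ε.1 ε.2).choose_spec.1
  have hf1 : ∀ ε, μ (Y ∩ Metric.closedBall x (f ε)) < ε.1 := fun ε => (hstep ε.1 ε.2).choose_spec.2
  -- Each ball's trace on `Y` has strictly smaller measure than the previous one, so the shells
  -- between consecutive balls have positive measure.
  let ρ : ℕ → {r : ℝ // 0 < r} := fun n => Nat.rec (⟨f ⟨δ 0, hδ 0⟩, hf0 _⟩)
    (fun n r => ⟨f ⟨min (δ (n + 1)) (μ (Y ∩ Metric.closedBall x r.1)),
      lt_min (hδ _) (hpos _ r.2)⟩, hf0 _⟩) n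
  let B : ℕ → Set Ω := fun n => Y ∩ Metric.closedBall x (ρ n).1
  have hlt : ∀ n, μ (B (n + 1)) < μ (B n) := fun n => (hf1 _).trans_le (min_le_right _ _)
  have hBδ : ∀ n, μ (B n) ≤ δ n := by
    rintro (_ | n)
    · exact (hf1 _).le
    · exact (hf1 _).le.trans (min_le_left _ _)
  have hanti : Antitone B := by
    refine antitone_nat_of_succ_le fun n => ?_
    rcases le_total (ρ (n + 1)).1 (ρ n).1 with h | h
    · exact inter_subset_inter_right _ (Metric.closedBall_subset_closedBall h)
    · exact absurd (measure_mono (inter_subset_inter_right _ (Metric.closedBall_subset_closedBall h)))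
        (hlt n).not_ge
  refine ⟨fun n => B n \ B (n + 1), fun n => (hmeas _).diff (hmeas _),
    fun n => sdiff_subset.trans inter_subset_left, ?_, fun n => ⟨?_, ?_⟩⟩
  · have h : ∀ m n, m < n → Disjoint (B m \ B (m + 1)) (B n \ B (n + 1)) := fun m n hmn =>
      disjoint_left.2 fun y hy hy' => hy.2 (hanti (Nat.succ_le_of_lt hmn) hy'.1)
    exact fun m n hmn => hmn.lt_or_gt.elim (h m n) fun hlt => (h n m hlt).symm
  · rw [measure_sdiff (hanti n.le_succ) (hmeas _).nullMeasurableSet (hfin' _)]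
    exact tsub_pos_of_lt (hlt n)
  · exact (measure_mono sdiff_subset).trans (hBδ n)

/-- Below a set of positive finite measure, there is a function in `L_p` which on each of countably
many disjoint pieces of its support is in no `L_q` with `q > p`. -/
theorem exists_memLp_not_memLp_on_pieces (𝕜 : Type u) [RCLike 𝕜] {Ω : Type v} [MetricSpace Ω]
    [SecondCountableTopology Ω] [MeasurableSpace Ω] [OpensMeasurableSpace Ω] {μ : Measure Ω}
    [NullSingletonClass μ] {Y : Set Ω} (hY : MeasurableSet Y) (h0 : μ Y ≠ 0) (hfin : μ Y ≠ ∞)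
    {p : ℝ≥0∞} (hp0 : 0 < p) (hp : p < ∞) :
    ∃ (g : Ω → 𝕜) (k : Ω → ℕ), Measurable g ∧ Measurable k ∧ MemLp g p μ ∧
      (∀ x ∉ Y, g x = 0) ∧
      ∀ q, p < q → ∀ i, ¬ MemLp ((k ⁻¹' {i}).indicator g) q μ := by
  have hpr : 0 < p.toReal := ENNReal.toReal_pos hp0.ne' hp.ne
  -- The bound `2^(-n²)` decays fast enough that any positive power of it beats `2^(-n)`.
  obtain ⟨Z, hZ, hZY, hZd, hZδ⟩ := exists_pairwise_disjoint_measure_le hY h0 hfin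
    (δ := fun n => 2⁻¹ ^ (n ^ 2)) (fun n => ENNReal.pow_pos (by simp) _)
  have hZfin : ∀ n, μ (Z n) ≠ ∞ := fun n => ne_top_of_le_ne_top hfin (measure_mono (hZY n))
  obtain ⟨N, hN, hNZ⟩ := exists_measurable_piecewise Z hZ (fun n _ => n)
    (fun n => measurable_const) (fun i j hij => by
      intro x hx
      exact absurd hx.2 (disjoint_left.1 (hZd hij) hx.1))
  -- Normalised so that the `L_p` norm of `g` on `Z n` is `2^(-n)`.
  let b : ℕ → ℝ := fun n => 2⁻¹ ^ n * ((μ (Z n)).toReal ^ (1 / p.toReal))⁻¹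
  let g : Ω → 𝕜 := (⋃ n, Z n).indicator fun x => ((b (N x) : ℝ) : 𝕜)
  have hU : MeasurableSet (⋃ n, Z n) := .iUnion hZ
  have hg : Measurable g :=
    (RCLike.measurable_ofReal.comp ((measurable_of_countable b).comp hN)).indicator hU
  have hgZ : ∀ n, ∀ x ∈ Z n, g x = (b n : 𝕜) := fun n x hx => by
    simp only [g, indicator_of_mem (mem_iUnion_of_mem n hx), hNZ n hx]
  have hnorm : ∀ n, eLpNorm g p (μ.restrict (Z n)) = 2⁻¹ ^ n := by
    intro n
    have hne : μ.restrict (Z n) ≠ 0 := by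
      rw [Ne, Measure.restrict_eq_zero]; exact (hZδ n).1.ne'
    rw [eLpNorm_congr_ae ((ae_restrict_iff' (hZ n)).2 (.of_forall (hgZ n))),
      eLpNorm_const _ hp0.ne' hne, Measure.restrict_apply_univ]
    have hpos : 0 < (μ (Z n)).toReal := ENNReal.toReal_pos (hZδ n).1.ne' (hZfin n)
    have hb : ‖(b n : 𝕜)‖ₑ = 2⁻¹ ^ n * (μ (Z n) ^ (1 / p.toReal))⁻¹ := by
      rw [← ofReal_norm, RCLike.norm_ofReal, abs_of_nonneg (by positivity),
        ENNReal.ofReal_mul (by positivity), ENNReal.ofReal_pow (by positivity),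
        ENNReal.ofReal_inv_of_pos (by positivity), ENNReal.ofReal_inv_of_pos (by positivity),
        ← ENNReal.ofReal_rpow_of_pos hpos, ENNReal.ofReal_toReal (hZfin n)]
      simp
    rw [hb, mul_assoc, ENNReal.inv_mul_cancel, mul_one]
    · simp [(hZδ n).1.ne', hpr.le]
    · exact ENNReal.rpow_ne_top_of_nonneg (by positivity) (hZfin n)
  -- Unpairing puts infinitely many of the `Z n` into each level set.
  refine ⟨g, fun x => (N x).unpair.1, hg, 
    (measurable_of_countable fun n : ℕ => n.unpair.1).comp hN, ⟨hg.aestronglyMeasurable, ?_⟩,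
    fun x hx => indicator_of_notMem (fun h => ?_) _, fun q hq i hmem => ?_⟩
  · have hgU : g = (⋃ n, Z n).indicator g := by simp [g, indicator_indicator]
    rw [hgU, eLpNorm_indicator_eq_eLpNorm_restrict hU,
      eLpNorm_lt_top_iff_lintegral_rpow_enorm_lt_top hp0.ne' hp.ne, lintegral_iUnion hZ hZd]
    have hterm : ∀ n, ∫⁻ x in Z n, ‖g x‖ₑ ^ p.toReal ∂μ = (2⁻¹ ^ p.toReal) ^ n := by
      intro n
      have h := hnorm n
      rw [eLpNorm_eq_lintegral_rpow_enorm_toReal hp0.ne' hp.ne] at h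
      rw [← ENNReal.rpow_natCast, ← ENNReal.rpow_mul, mul_comm, ENNReal.rpow_mul,
        ENNReal.rpow_natCast, ← h, ← ENNReal.rpow_mul, one_div_mul_cancel hpr.ne',
        ENNReal.rpow_one]
    simp_rw [hterm]
    rw [ENNReal.tsum_geometric]
    refine ENNReal.inv_lt_top.2 (tsub_pos_of_lt (ENNReal.rpow_lt_one (by simp) hpr))
  · obtain ⟨n, hn⟩ := mem_iUnion.1 h
    exact hx (hZY n hn)
  · set s : ℝ := 1 / p.toReal - 1 / q.toReal with hs
    have hs0 : 0 < s := by
      rcases eq_or_ne q ∞ with rfl | hq'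
      · simpa [hs] using hpr
      · exact sub_pos.2 (one_div_lt_one_div_of_lt hpr ((ENNReal.toReal_lt_toReal hp.ne hq').2 hq))
    set C := eLpNorm ((((fun x => (N x).unpair.1) ⁻¹' {i})).indicator g) q μ
    have hC : C ≠ ∞ := hmem.2.ne
    -- Hölder on `Z n`: the `p`-norm is at most the `q`-norm times `μ (Z n) ^ (1/p - 1/q)`.
    have hle : ∀ n : ℕ, n.unpair.1 = i → (2⁻¹ : ℝ≥0∞) ^ n ≤ C * (2⁻¹ ^ (n ^ 2)) ^ s := by
      intro n hn
      have hgi : eLpNorm g q (μ.restrict (Z n)) ≤ C := by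
        refine le_trans (le_of_eq (eLpNorm_congr_ae ((ae_restrict_iff' (hZ n)).2
          (.of_forall fun x hx => ?_)))) (eLpNorm_restrict_le _ q μ (Z n))
        rw [indicator_of_mem]
        simp [hNZ n hx, hn]
      rw [← hnorm n]
      refine (eLpNorm_le_eLpNorm_mul_rpow_measure_univ hq.le hg.aestronglyMeasurable).trans ?_
      rw [Measure.restrict_apply_univ]
      gcongr
      exact (hZδ n).2
    obtain ⟨m, hm⟩ := ENNReal.exists_inv_two_pow_lt (ENNReal.inv_ne_zero.2 hC)
    obtain ⟨l, hl⟩ := exists_nat_ge (2 / s)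
    -- An index in row `i` with `n ≥ m`, giving `C 2^(-n) < 1`, and `n ≥ 2/s`, giving `2^(-n² s) ≤
    -- 4^(-n)`; together they contradict `hle`.
    let n := Nat.pair i (max m l)
    have hmn : m ≤ n := (le_max_left _ _).trans (Nat.right_le_pair _ _)
    have hln : l ≤ n := (le_max_right _ _).trans (Nat.right_le_pair _ _)
    have h2 : 2 ≤ n * s := by
      rw [← div_le_iff₀ hs0]
      exact hl.trans (by exact_mod_cast hln)
    have hpow : ((2⁻¹ : ℝ≥0∞) ^ (n ^ 2)) ^ s ≤ 2⁻¹ ^ n * 2⁻¹ ^ n := by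
      rw [← pow_add, ← ENNReal.rpow_natCast, ← ENNReal.rpow_natCast, ← ENNReal.rpow_mul]
      refine ENNReal.rpow_le_rpow_of_exponent_ge (by simp) ?_
      push_cast
      nlinarith [n.cast_nonneg (α := ℝ)]
    have h := (hle n (by simp [n])).trans (mul_le_mul_right hpow C)
    have hlt : C * 2⁻¹ ^ n < 1 := by
      refine ENNReal.mul_lt_of_lt_div' ?_
      rw [one_div]
      exact (pow_le_pow_right_of_le_one' (by simp) hmn).trans_lt hm
    have hpos : (2⁻¹ : ℝ≥0∞) ^ n ≠ 0 := (ENNReal.pow_pos (by simp) n).ne'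
    have hfin2 : (2⁻¹ : ℝ≥0∞) ^ n ≠ ∞ := ENNReal.pow_ne_top (by simp)
    rw [← mul_assoc] at h
    exact absurd (ENNReal.mul_lt_mul_left hpos hfin2 hlt) (by rw [one_mul]; exact h.not_gt)

/-! ### Closedness -/

/-- A subset of `L_p` that is closed under almost everywhere convergent sequences is closed. -/
theorem isClosed_lpTopology_of_ae_tendsto {𝕜 : Type u} [RCLike 𝕜] {Ω : Type v} [MeasurableSpace Ω]
    {p : ℝ≥0∞} {μ : Measure Ω} (hp0 : p ≠ 0) {S : Set (Lp 𝕜 p μ)}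
    (h : ∀ (u : ℕ → Lp 𝕜 p μ) (φ : Lp 𝕜 p μ), (∀ n, u n ∈ S) →
      (∀ᵐ x ∂μ, Tendsto (fun n => u n x) atTop (𝓝 (φ x))) → φ ∈ S) :
    IsClosed[lpTopology 𝕜 p μ] S := by
  refine @IsClosed.mk _ (lpTopology 𝕜 p μ) _ fun φ hφ => ?_
  by_contra! hcon
  choose u hu huS using fun n : ℕ => hcon (1 / (n + 1)) Nat.one_div_pos_of_nat
  have hlim : Tendsto (fun n => ‖u n - φ‖) atTop (𝓝 0) :=
    squeeze_zero (fun n => ENNReal.toReal_nonneg) (fun n => (hu n).le)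
      tendsto_one_div_add_atTop_nhds_zero_nat
  have hmeas : TendstoInMeasure μ (fun n => (u n : Ω → 𝕜)) atTop φ := by
    refine tendstoInMeasure_of_tendsto_eLpNorm hp0 (fun n => Lp.aestronglyMeasurable _)
      (Lp.aestronglyMeasurable _) ?_
    have := ENNReal.tendsto_ofReal hlim
    rw [ENNReal.ofReal_zero] at this
    refine this.congr fun n => ?_
    rw [Lp.norm_def, ENNReal.ofReal_toReal (Lp.eLpNorm_ne_top _)]
    exact eLpNorm_congr_ae (Lp.coeFn_sub _ _)
  obtain ⟨ns, -, hns⟩ := hmeas.exists_seq_tendsto_ae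
  exact hφ (h (fun n => u (ns n)) φ (fun n => not_not.1 (huS _)) hns)

/-- The multiples `c (k x) g(x)` of `g` by a scalar on each level set of `k`. -/
def fiberMultiples (𝕜 : Type u) [Field 𝕜] {S : Type v} (g : S → 𝕜) (k : S → ℕ) :
    Submodule 𝕜 (S → 𝕜) where
  carrier := {h | ∃ c : ℕ → 𝕜, h = fun x => c (k x) * g x}
  add_mem' := by
    rintro _ _ ⟨c, rfl⟩ ⟨d, rfl⟩
    exact ⟨c + d, by ext x; simp [add_mul]⟩
  zero_mem' := ⟨0, by ext x; simp⟩
  smul_mem' := by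
    rintro a _ ⟨c, rfl⟩
    exact ⟨a • c, by ext x; simp [mul_assoc]⟩

/-- Cross-multiplying on each fibre eliminates `c` and leaves pointwise closed conditions. -/
theorem isClosed_fiberMultiples (𝕜 : Type u) [RCLike 𝕜] {S : Type v} (g : S → 𝕜) (k : S → ℕ) :
    IsClosed (fiberMultiples 𝕜 g k : Set (S → 𝕜)) := by
  have : (fiberMultiples 𝕜 g k : Set (S → 𝕜)) =
      {h | ∀ x y, k x = k y → h x * g y = h y * g x} ∩ {h | ∀ x, g x = 0 → h x = 0} := by
    ext h
    constructor
    · rintro ⟨c, rfl⟩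
      refine ⟨fun x y hxy => ?_, fun x hx => by simp [hx]⟩
      simp only [hxy]
      ring
    · rintro ⟨h1, h2⟩
      classical
      refine ⟨fun n => if H : ∃ y, k y = n ∧ g y ≠ 0 then h H.choose / g H.choose else 0, ?_⟩
      ext x
      by_cases hx : g x = 0
      · simp [hx, h2 x hx]
      · have H : ∃ y, k y = k x ∧ g y ≠ 0 := ⟨x, rfl, hx⟩
        dsimp only
        rw [dif_pos H, div_mul_eq_mul_div, eq_div_iff H.choose_spec.2]
        exact h1 x _ H.choose_spec.1.symm
  rw [this]
  simp only [ofPred_forall]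
  refine IsClosed.inter ?_ ?_
  · exact isClosed_iInter fun x => isClosed_iInter fun y => isClosed_iInter fun _ =>
      isClosed_eq (by fun_prop) (by fun_prop)
  · exact isClosed_iInter fun x => isClosed_iInter fun _ => isClosed_eq (by fun_prop) (by fun_prop)

/-- The elements of `L_p` that are a scalar multiple of `g` on each level set of `k`. -/
def lpFiberMultiples {𝕜 : Type u} [RCLike 𝕜] {Ω : Type v} [MeasurableSpace Ω]
    (p : ℝ≥0∞) (μ : Measure Ω) (g : Ω → 𝕜) (k : Ω → ℕ) : Submodule 𝕜 (Lp 𝕜 p μ) where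
  carrier := {φ | ∃ c : ℕ → 𝕜, φ =ᵐ[μ] fun x => c (k x) * g x}
  add_mem' := by
    rintro φ ψ ⟨c, hc⟩ ⟨d, hd⟩
    refine ⟨c + d, ?_⟩
    filter_upwards [hc, hd, Lp.coeFn_add φ ψ] with x h1 h2 h3
    rw [h3, Pi.add_apply, h1, h2, Pi.add_apply, add_mul]
  zero_mem' := ⟨0, by filter_upwards [Lp.coeFn_zero 𝕜 p μ] with x hx; rw [hx]; simp⟩
  smul_mem' := by
    rintro a φ ⟨c, hc⟩
    refine ⟨a • c, ?_⟩
    filter_upwards [hc, Lp.coeFn_smul a φ] with x h1 h2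
    simp [h1, h2, mul_assoc]

section

variable {𝕜 : Type u} [RCLike 𝕜] {Ω : Type v} [MeasurableSpace Ω] {p : ℝ≥0∞} {μ : Measure Ω}
  {g : Ω → 𝕜} {k : Ω → ℕ}

theorem Lp.coeFn_sum_smul {ι : Type*} (s : Finset ι) (e : ι → Lp 𝕜 p μ) (a : ι → 𝕜) :
    (∑ i ∈ s, a i • e i : Lp 𝕜 p μ) =ᵐ[μ] fun x => ∑ i ∈ s, a i * e i x := by
  classical
  induction s using Finset.induction_on with
  | empty =>
    filter_upwards [Lp.coeFn_zero 𝕜 p μ] with x hx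
    rw [Finset.sum_empty, hx, Finset.sum_empty, Pi.zero_apply]
  | insert i s hi ih =>
    rw [Finset.sum_insert hi]
    filter_upwards [ih, Lp.coeFn_add (a i • e i) (∑ i ∈ s, a i • e i),
      Lp.coeFn_smul (a i) (e i)] with x h1 h2 h3
    rw [h2, Finset.sum_insert hi, Pi.add_apply, h1, h3, Pi.smul_apply, smul_eq_mul]

/-- Countably many a.e. identities hold on one conull set `S`. In `S → 𝕜` with the product topology,
a closed subspace plus a finite-dimensional one is closed, so the pointwise limit again has the
required form. This works uniformly in `p`, including `p < 1`. -/
theorem isClosed_sup_lpFiberMultiples (hp0 : p ≠ 0) (F : Submodule 𝕜 (Lp 𝕜 p μ))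
    [FiniteDimensional 𝕜 F] :
    IsClosed[lpTopology 𝕜 p μ] ((F ⊔ lpFiberMultiples p μ g k : Submodule 𝕜 (Lp 𝕜 p μ)) :
      Set (Lp 𝕜 p μ)) := by
  refine isClosed_lpTopology_of_ae_tendsto hp0 fun u φ hu hlim => ?_
  choose f hf ψ hψ hu using fun n => Submodule.mem_sup.1 (hu n)
  choose c hc using hψ
  let b := Module.finBasis 𝕜 F
  let a : ℕ → Fin (Module.finrank 𝕜 F) → 𝕜 := fun n => b.repr ⟨f n, hf n⟩
  have hfa : ∀ n, ∑ i, a n i • (b i : Lp 𝕜 p μ) = f n := fun n => by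
    have := congrArg Subtype.val (b.sum_repr ⟨f n, hf n⟩)
    rwa [Submodule.coe_sum] at this
  have hae : ∀ᵐ x ∂μ, (∀ n, u n x = ∑ i, a n i * (b i : Lp 𝕜 p μ) x + c n (k x) * g x) ∧
      Tendsto (fun n => u n x) atTop (𝓝 (φ x)) := by
    refine (ae_all_iff.2 fun n => ?_).and hlim
    filter_upwards [hc n, Lp.coeFn_add (f n) (ψ n),
      Lp.coeFn_sum_smul Finset.univ (fun i => (b i : Lp 𝕜 p μ)) (a n)] with x h1 h2 h3
    rw [← hu n, h2, Pi.add_apply, h1, ← hfa n, h3]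
  let S := {x | (∀ n, u n x = ∑ i, a n i * (b i : Lp 𝕜 p μ) x + c n (k x) * g x) ∧
      Tendsto (fun n => u n x) atTop (𝓝 (φ x))}
  let e : Fin (Module.finrank 𝕜 F) → S → 𝕜 := fun i x => (b i : Lp 𝕜 p μ) x
  let W := fiberMultiples 𝕜 (fun x : S => g x) (fun x : S => k x)
  have : FiniteDimensional 𝕜 (Submodule.span 𝕜 (range e)) := .span_of_finite 𝕜 (finite_range e)
  have hclosed := Submodule.isClosed_sup_finiteDimensional W (Submodule.span 𝕜 (range e))
    (isClosed_fiberMultiples 𝕜 _ _)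
  have hmem : (fun x : S => φ x) ∈ W ⊔ Submodule.span 𝕜 (range e) := by
    refine hclosed.mem_of_tendsto (f := fun n => fun x : S => u n x)
      (tendsto_pi_nhds.2 fun x => x.2.2) (.of_forall fun n => ?_)
    refine Submodule.mem_sup.2 ⟨fun x => c n (k x) * g x, ⟨c n, rfl⟩, ∑ i, a n i • e i,
      Submodule.sum_mem _ fun i _ => Submodule.smul_mem _ _
        (Submodule.subset_span (mem_range_self i)), ?_⟩
    ext x
    simp [x.2.1 n, e, add_comm]
  obtain ⟨w, ⟨d, rfl⟩, y, hy, hsum⟩ := Submodule.mem_sup.1 hmem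
  obtain ⟨t, rfl⟩ := (Submodule.mem_span_range_iff_exists_fun 𝕜).1 hy
  let f₀ : Lp 𝕜 p μ := ∑ i, t i • (b i : Lp 𝕜 p μ)
  refine Submodule.mem_sup.2 ⟨f₀, Submodule.sum_mem _ fun i _ => Submodule.smul_mem _ _ (b i).2,
    φ - f₀, ⟨d, ?_⟩, add_sub_cancel _ _⟩
  filter_upwards [hae, Lp.coeFn_sub φ f₀,
    Lp.coeFn_sum_smul Finset.univ (fun i => (b i : Lp 𝕜 p μ)) t] with x h1 h2 h3
  have := congrFun hsum ⟨x, h1⟩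
  simp only [Pi.add_apply, Finset.sum_apply, Pi.smul_apply, smul_eq_mul, e] at this
  rw [h2, Pi.sub_apply, ← this, h3]
  ring

/-- Adding multiples of `g` to a subspace of `L_p` creates no element in a smaller `L_q`, if the
subspace consists of functions that are bounded on the support of `g`. -/
theorem sup_lpFiberMultiples_subset_lpDiffUnion {Y : Set Ω} (hY : MeasurableSet Y)
    (hfin : μ Y ≠ ∞) (hk : Measurable k) (hgY : ∀ x ∉ Y, g x = 0)
    (hgq : ∀ q, p < q → ∀ i, ¬ MemLp ((k ⁻¹' {i}).indicator g) q μ)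
    {F : Submodule 𝕜 (Lp 𝕜 p μ)} (hF : (F : Set (Lp 𝕜 p μ)) ⊆ lpDiffUnion 𝕜 p μ ∪ {0})
    (hbdd : ∀ f ∈ F, ∃ C : ℝ, ∀ᵐ x ∂μ, x ∈ Y → ‖f x‖ ≤ C) :
    ((F ⊔ lpFiberMultiples p μ g k : Submodule 𝕜 (Lp 𝕜 p μ)) : Set (Lp 𝕜 p μ)) ⊆
      lpDiffUnion 𝕜 p μ ∪ {0} := by
  intro φ hφ
  obtain ⟨f, hf, ψ, ⟨c, hc⟩, rfl⟩ := Submodule.mem_sup.1 hφ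
  by_contra hcon
  simp only [lpDiffUnion, mem_union, mem_ofPred_eq, not_or, not_not, mem_iUnion, mem_singleton_iff,
    exists_prop] at hcon
  obtain ⟨⟨q, hq, hLq⟩, hne⟩ := hcon
  have hLq : MemLp (f + ψ : Lp 𝕜 p μ) q μ := Lp.mem_Lp_iff_memLp.1 hLq
  have hfY : MemLp (Y.indicator f) q μ := by
    obtain ⟨C, hC⟩ := hbdd f hf
    rw [memLp_indicator_iff_restrict hY]
    have : IsFiniteMeasure (μ.restrict Y) := ⟨by simpa using hfin.lt_top⟩
    exact MemLp.of_bound (Lp.aestronglyMeasurable f).restrict C ((ae_restrict_iff' hY).2 hC)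
  have hfq : MemLp f q μ := by
    refine (memLp_congr_ae ?_).1 ((hLq.indicator hY.compl).add hfY)
    filter_upwards [hc, Lp.coeFn_add f ψ] with x h1 h2
    by_cases hx : x ∈ Y
    · simp [hx]
    · rw [Pi.add_apply, indicator_of_mem (mem_compl hx), indicator_of_notMem hx, h2, Pi.add_apply, h1,
        hgY x hx, mul_zero, add_zero, add_zero]
  have hf0 : f = 0 := by
    rcases hF hf with h | h
    · exact absurd (mem_iUnion₂.2 ⟨q, hq, Lp.mem_Lp_iff_memLp.2 hfq⟩) h
    · exact h
  subst hf0
  rw [zero_add] at hLq hne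
  have hc0 : ∀ i, c i = 0 := by
    intro i
    by_contra hi
    refine hgq q hq.1 i ((memLp_congr_ae ?_).1
      ((hLq.indicator (hk (measurableSet_singleton i))).const_mul (c i)⁻¹))
    filter_upwards [hc] with x hx
    by_cases hxi : k x = i
    · simp [hxi, hx, hi]
    · simp [hxi]
  refine hne (Lp.eq_zero_iff_ae_eq_zero.2 ?_)
  filter_upwards [hc] with x hx
  simp [hx, hc0]

end

/-! ### Dimension and the bounded set -/

theorem mk_rclike_le_continuum (𝕜 : Type u) [RCLike 𝕜] : #𝕜 ≤ 𝔠 := by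
  have h : Function.Injective fun z : 𝕜 => (RCLike.re z, RCLike.im z) := fun z w hzw =>
    RCLike.ext (congrArg Prod.fst hzw) (congrArg Prod.snd hzw)
  have h2 := Cardinal.lift_mk_le_lift_mk_of_injective h
  simpa [Cardinal.mk_real] using h2

section

variable {𝕜 : Type u} [RCLike 𝕜] {Ω : Type} [MeasurableSpace Ω] {p : ℝ≥0∞} {μ : Measure Ω}
  {g : Ω → 𝕜} {k : Ω → ℕ}

theorem mk_sup_lpFiberMultiples_le (F : Submodule 𝕜 (Lp 𝕜 p μ)) [FiniteDimensional 𝕜 F] :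
    #(F ⊔ lpFiberMultiples p μ g k : Submodule 𝕜 (Lp 𝕜 p μ)) ≤ 𝔠 := by
  have h : ∀ φ : (F ⊔ lpFiberMultiples p μ g k : Submodule 𝕜 (Lp 𝕜 p μ)),
      ∃ q : F × (ℕ → 𝕜), ∃ ψ : Lp 𝕜 p μ, ψ =ᵐ[μ] (fun x => q.2 (k x) * g x) ∧ q.1 + ψ = φ.1 := by
    intro φ
    obtain ⟨f, hf, ψ, ⟨c, hc⟩, hφ⟩ := Submodule.mem_sup.1 φ.2
    exact ⟨(⟨f, hf⟩, c), ψ, hc, hφ⟩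
  choose q ψ hψ hq using h
  have hinj : Function.Injective q := fun φ φ' hqq => by
    have : ψ φ = ψ φ' := Lp.ext ((hψ φ).trans (hqq ▸ (hψ φ').symm))
    exact Subtype.ext (by rw [← hq φ, ← hq φ', hqq, this])
  have hF : #F ≤ 𝔠 := by
    rw [Cardinal.mk_congr (Module.finBasis 𝕜 F).equivFun.toEquiv]
    simpa using (Cardinal.power_le_power_right (mk_rclike_le_continuum 𝕜)).trans
      (Cardinal.continuum_power_aleph0.le.trans' (Cardinal.power_le_power_left
        Cardinal.continuum_ne_zero (Cardinal.natCast_le_aleph0 (n := Module.finrank 𝕜 F))))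
  have hN : #(ℕ → 𝕜) ≤ 𝔠 := by
    simpa using (Cardinal.power_le_power_right (c := ℵ₀) (mk_rclike_le_continuum 𝕜))
  refine (Cardinal.mk_le_of_injective hinj).trans ?_
  rw [Cardinal.mk_prod, Cardinal.lift_id, Cardinal.lift_id]
  exact (mul_le_mul' hF hN).trans (by simp)

/-- The functions `t^k g` with `0 < t < 1` are dominated by `g`. They are independent because the
characters `n ↦ t^n` are (Dedekind), and a relation can be read off on each level set, where `g` is
not a.e. zero. -/
theorem continuum_le_rank_lpFiberMultiples (hk : Measurable k) (hg : MemLp g p μ)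
    (hgk : ∀ i, ¬ (k ⁻¹' {i}).indicator g =ᵐ[μ] 0) :
    𝔠 ≤ Module.rank 𝕜 (lpFiberMultiples p μ g k) := by
  have hmem : ∀ t : Ioo (0 : ℝ) 1, MemLp (fun x => ((t : ℝ) : 𝕜) ^ k x * g x) p μ := by
    intro t
    refine hg.of_le_mul (c := 1) (AEStronglyMeasurable.mul
      ((measurable_of_countable _).comp hk).aestronglyMeasurable hg.1) (.of_forall fun x => ?_)
    rw [norm_mul, norm_pow, RCLike.norm_ofReal, abs_of_pos t.2.1]
    gcongr
    exact pow_le_one₀ t.2.1.le t.2.2.le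
  let v : Ioo (0 : ℝ) 1 → lpFiberMultiples p μ g k := fun t =>
    ⟨(hmem t).toLp _, fun n => ((t : ℝ) : 𝕜) ^ n, (hmem t).coeFn_toLp⟩
  have hinj : Function.Injective fun t : Ioo (0 : ℝ) 1 => powersHom 𝕜 ((t : ℝ) : 𝕜) := fun s t h =>
    Subtype.ext (RCLike.ofReal_injective ((powersHom 𝕜).injective h))
  have hind := (linearIndependent_monoidHom (Multiplicative ℕ) 𝕜).comp _ hinj
  have hv : LinearIndependent 𝕜 v := by
    refine linearIndependent_iff'.2 fun s a hs => linearIndependent_iff'.1 hind s a ?_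
    have hs' : ∑ t ∈ s, a t • (hmem t).toLp _ = 0 := by
      have := congrArg Subtype.val hs
      rwa [Submodule.coe_sum] at this
    have h1 := Lp.coeFn_sum_smul s (fun t => (hmem t).toLp _) a
    rw [hs'] at h1
    have h2 : ∀ᵐ x ∂μ, ∀ t : s, (hmem t).toLp _ x = ((t : ℝ) : 𝕜) ^ k x * g x :=
      ae_all_iff.2 fun t => (hmem t).coeFn_toLp
    ext i
    by_contra hi
    refine hgk i.toAdd ?_
    filter_upwards [h1, h2, Lp.coeFn_zero 𝕜 p μ] with x hx1 hx2 hx3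
    by_cases hxi : k x = i.toAdd
    · rw [indicator_of_mem (by exact hxi), Pi.zero_apply]
      have hterm : ∀ t ∈ s, a t * (hmem t).toLp _ x = a t * ((t : ℝ) : 𝕜) ^ k x * g x :=
        fun t ht => by rw [hx2 ⟨t, ht⟩, mul_assoc]
      rw [hx3, Pi.zero_apply, Finset.sum_congr rfl hterm, ← Finset.sum_mul, eq_comm, mul_eq_zero] at hx1
      refine hx1.resolve_left fun h => hi ?_
      simpa [hxi, powersHom_apply] using h
    · rw [indicator_of_notMem (by exact hxi), Pi.zero_apply]
  have := hv.cardinal_lift_le_rank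
  rwa [Cardinal.mk_Ioo_real one_pos, Cardinal.lift_continuum, Cardinal.lift_id'.{0, u}] at this

/-- Countably many sets of finite measure, on each of which a basis of `F` is bounded, cover the
space; one of them is not null. -/
theorem exists_bounded_on_measurableSet [SigmaFinite μ] (hμ : μ ≠ 0) (F : Submodule 𝕜 (Lp 𝕜 p μ))
    [FiniteDimensional 𝕜 F] :
    ∃ Y : Set Ω, MeasurableSet Y ∧ μ Y ≠ 0 ∧ μ Y ≠ ∞ ∧
      ∀ f ∈ F, ∃ C : ℝ, ∀ᵐ x ∂μ, x ∈ Y → ‖f x‖ ≤ C := by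
  let b := Module.finBasis 𝕜 F
  let T : ℕ × ℕ → Set Ω := fun n =>
    spanningSets μ n.1 ∩ ⋂ i, {x | ‖(b i : Lp 𝕜 p μ) x‖ ≤ n.2}
  have hT : ⋃ n, T n = Set.univ := by
    refine eq_univ_of_forall fun x => mem_iUnion.2 ?_
    obtain ⟨n, hn⟩ := mem_iUnion.1 ((iUnion_spanningSets μ).symm ▸ Set.mem_univ x)
    obtain ⟨M, hM⟩ := exists_nat_ge (∑ i, ‖(b i : Lp 𝕜 p μ) x‖)
    refine ⟨(n, M), hn, mem_iInter.2 fun i => le_trans ?_ hM⟩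
    exact Finset.single_le_sum (f := fun i => ‖(b i : Lp 𝕜 p μ) x‖) (fun _ _ => norm_nonneg _)
      (Finset.mem_univ i)
  obtain ⟨⟨n, M⟩, hpos⟩ := exists_measure_pos_of_not_measure_iUnion_null (μ := μ) (s := T)
    (by rw [hT]; exact Measure.measure_univ_ne_zero.2 hμ)
  refine ⟨T (n, M), (measurableSet_spanningSets μ n).inter (.iInter fun i =>
    measurableSet_le (Lp.stronglyMeasurable _).norm.measurable measurable_const), hpos.ne',
    ((measure_mono inter_subset_left).trans_lt (measure_spanningSets_lt_top μ n)).ne, ?_⟩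
  intro f hf
  have hsum : ∑ i, b.repr ⟨f, hf⟩ i • (b i : Lp 𝕜 p μ) = f := by
    have := congrArg Subtype.val (b.sum_repr ⟨f, hf⟩)
    rwa [Submodule.coe_sum] at this
  refine ⟨∑ i, ‖b.repr ⟨f, hf⟩ i‖ * M, ?_⟩
  have h1 := Lp.coeFn_sum_smul Finset.univ (fun i => (b i : Lp 𝕜 p μ)) (b.repr ⟨f, hf⟩)
  rw [hsum] at h1
  filter_upwards [h1] with x hx hxY
  rw [hx]
  refine (norm_sum_le _ _).trans (Finset.sum_le_sum fun i _ => ?_)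
  rw [norm_mul]
  exact mul_le_mul_of_nonneg_left (mem_iInter.1 hxY.2 i) (norm_nonneg _)

end

theorem IsLineable.of_le {𝕜 : Type u} {E : Type v} [Field 𝕜] [AddCommGroup E] [Module 𝕜 E]
    {A : Set E} {α β : Cardinal.{v}} (h : IsLineable 𝕜 A β) (hα : α ≤ β) : IsLineable 𝕜 A α := by
  obtain ⟨F, rfl, hF⟩ := h
  obtain ⟨s, hs, hind⟩ := le_rank_iff_exists_linearIndependent.1 hα
  refine ⟨(Submodule.span 𝕜 s).map F.subtype, ?_, fun x hx => hF ⟨?_, hx.2⟩⟩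
  · rw [← (Submodule.equivMapOfInjective F.subtype F.injective_subtype _).rank_eq,
      rank_span_set hind, hs]
  · obtain ⟨y, -, rfl⟩ := hx.1
    exact y.2

/-- In a non-atomic nonzero measure on a separable metric space, every finite-dimensional subspace
of `L_p \ ⋃_{q > p} L_q` lies in a closed such subspace of dimension continuum. -/
theorem exists_isClosed_submodule_subset_lpDiffUnion {𝕜 : Type u} [RCLike 𝕜] {Ω : Type}
    [MetricSpace Ω] [SecondCountableTopology Ω] [MeasurableSpace Ω] [OpensMeasurableSpace Ω]
    {μ : Measure Ω} [SigmaFinite μ] [NullSingletonClass μ] (hμ : μ ≠ 0) {p : ℝ≥0∞} (hp0 : 0 < p)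
    (hp : p < ∞) (F : Submodule 𝕜 (Lp 𝕜 p μ)) [FiniteDimensional 𝕜 F]
    (hF : (F : Set (Lp 𝕜 p μ)) ⊆ lpDiffUnion 𝕜 p μ ∪ {0}) :
    ∃ G : Submodule 𝕜 (Lp 𝕜 p μ), Module.rank 𝕜 G = 𝔠 ∧ F ≤ G ∧
      (G : Set (Lp 𝕜 p μ)) ⊆ lpDiffUnion 𝕜 p μ ∪ {0} ∧
        IsClosed[lpTopology 𝕜 p μ] (G : Set (Lp 𝕜 p μ)) := by
  obtain ⟨Y, hY, hY0, hYfin, hbdd⟩ := exists_bounded_on_measurableSet hμ F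
  obtain ⟨g, k, -, hk, hgp, hgY, hgq⟩ := exists_memLp_not_memLp_on_pieces 𝕜 hY hY0 hYfin hp0 hp
  refine ⟨F ⊔ lpFiberMultiples p μ g k, le_antisymm ?_ ?_, le_sup_left,
    sup_lpFiberMultiples_subset_lpDiffUnion hY hYfin hk hgY hgq hF hbdd,
    isClosed_sup_lpFiberMultiples hp0.ne' F⟩
  · exact (rank_le_card 𝕜 _).trans (mk_sup_lpFiberMultiples_le F)
  · refine (continuum_le_rank_lpFiberMultiples hk hgp fun i h => ?_).trans
      (Submodule.rank_mono le_sup_right)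
    exact hgq ∞ hp i ((memLp_congr_ae h).2 MemLp.zero)

/-- `L_p(X)` is `Lp 𝕜 p (volume.restrict X)`, and Lebesgue measurable sets are the
`NullMeasurableSet`s of the Lebesgue measure `volume`. -/
theorem corollaryc38 {𝕜 : Type u} [RCLike 𝕜] (m : ℕ) (hm : 1 ≤ m) (p : ℝ≥0∞)
    (hp₀ : 0 < p) (hp : p < ∞) (X : Set (EuclideanSpace ℝ (Fin m)))
    (hX : NullMeasurableSet X volume) :
    0 < volume X ↔
      ∀ α : Cardinal.{u}, α < ℵ₀ →
        IsSpaceable 𝕜 (lpTopology 𝕜 p (volume.restrict X))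
          (lpDiffUnion 𝕜 p (volume.restrict X)) α 𝔠 := by
  constructor
  · intro hpos α hα
    have : Nonempty (Fin m) := ⟨⟨0, hm⟩⟩
    have hμ : volume.restrict X ≠ 0 := by
      rw [Ne, Measure.restrict_eq_zero]
      exact hpos.ne'
    refine ⟨IsLineable.of_le (β := 𝔠) ?_ (hα.le.trans aleph0_le_continuum), fun F hFα hF => ?_⟩
    -- Lineability comes from extending the zero subspace and shrinking the result.
    · obtain ⟨G, hG, -, hGA, -⟩ := exists_isClosed_submodule_subset_lpDiffUnion (𝕜 := 𝕜) hμ hp₀ hp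
        ⊥ (by simp)
      exact ⟨G, hG, fun x hx => (hGA hx.1).resolve_right hx.2⟩
    · have : FiniteDimensional 𝕜 F := Module.rank_lt_aleph0_iff.1 (hFα ▸ hα)
      exact exists_isClosed_submodule_subset_lpDiffUnion hμ hp₀ hp F hF
  · intro h
    by_contra hX0
    have hμ : volume.restrict X = 0 := Measure.restrict_eq_zero.2 (by simpa using hX0)
    obtain ⟨⟨F, hF, -⟩, -⟩ := h 1 one_lt_aleph0
    have hsub : ∀ f : Lp 𝕜 p (volume.restrict X), f = 0 := fun f =>
      Lp.eq_zero_iff_ae_eq_zero.2 (ae_iff.2 (by simp [hμ]))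
    have : Subsingleton F := ⟨fun a b => Subtype.ext ((hsub a).trans (hsub b).symm)⟩
    rw [rank_subsingleton'] at hF
    exact zero_ne_one hF
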